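/- **Do-calculus in causal C-DAGs.** Let $G$ be an ADMG (a finite graph with directed edges forming no directed cycle, and bidirected edges) over a set $\mathbf V$ of discrete variables, and let $\mathbf C=\{\mathbf C_1,\dots,\mathbf C_k\}$ be a partition of $\mathbf V$ into nonempty clusters. Let $G_{\mathbf C}$ be the graph over the clusters with $\mathbf C_i\to\mathbf C_j$ (resp. $\mathbf C_i\leftrightarrow\mathbf C_j$), $i\ne j$, whenever $V_i\to V_j$ (resp. $V_i\leftrightarrow V_j$) in $G$ for some $V_i\in\mathbf C_i$, $V_j\in\mathbf C_j$; suppose that $G_{\mathbf C}$ has no directed cycle, i.e. that it is a C-DAG compatible with $G$. Suppose that $G$ is a causal Bayesian network encoding the interventional distributions $P(\cdot\mid do(\cdot))$: there are finitely many mutually independent discrete latent variables $\mathbf U$ with joint distribution $P(\mathbf u)$, a set $\mathbf U_k\subseteq\mathbf U$ of latent parents for each $V_k$, such that distinct $V_i,V_j$ are joined by a bidirected edge in $G$ if and only if $\mathbf U_i\cap\mathbf U_j\neq\emptyset$, and conditional distributions $P(v_k\mid pa_{V_k},\mathbf u_k)$, where $Pa_{V_k}$ are the parents of $V_k$ in $G$,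 such that for every $\mathbf X\subseteq\mathbf V$ and every $\mathbf x$ $$P(\mathbf v\setminus\mathbf x\mid do(\mathbf x))=\sum_{\mathbf u}P(\mathbf u)\prod_{k:\,V_k\in\mathbf V\setminus\mathbf X}P(v_k\mid pa_{V_k},\mathbf u_k).$$ For a graph $H$ and sets of its vertices, let $H_{\overline{\mathbf X}}$ be obtained from $H$ by removing all edges with an arrowhead into $\mathbf X$, and $H_{\overline{\mathbf X}\underline{\mathbf Z}}$ by removing in addition all directed edges out of $\mathbf Z$. Write $(\mathbf Y\perp\!\!\!\perp\mathbf Z\mid\mathbf T)_H$ for d-separation: every path in $H$ between a vertex of $\mathbf Y$ and a vertex of $\mathbf Z$ contains an interior vertex that is either a non-collider in $\mathbf T$, or a collider such that neither it nor any of its descendants is in $\mathbf T$. Then for all pairwise disjoint sets of clusters $\mathbf X,\mathbf Y,\mathbf Z,\mathbf W\subseteq\mathbf C$ and all values $\mathbf x,\mathbf y,\mathbf z,\mathbf w$ of their variables for which the conditioning events have positive probability: - **Rule 1:** $P(\mathbf y\mid do(\mathbf x),\mathbf z,\mathbf w)=P(\mathbf y\mid do(\mathbf x),\mathbf w)$ if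 $(\mathbf Y\perp\!\!\!\perp\mathbf Z\mid\mathbf X,\mathbf W)_{G_{\mathbf C_{\overline{\mathbf X}}}}$; - **Rule 2:** $P(\mathbf y\mid do(\mathbf x),do(\mathbf z),\mathbf w)=P(\mathbf y\mid do(\mathbf x),\mathbf z,\mathbf w)$ if $(\mathbf Y\perp\!\!\!\perp\mathbf Z\mid\mathbf X,\mathbf W)_{G_{\mathbf C_{\overline{\mathbf X}\underline{\mathbf Z}}}}$; - **Rule 3:** $P(\mathbf y\mid do(\mathbf x),do(\mathbf z),\mathbf w)=P(\mathbf y\mid do(\mathbf x),\mathbf w)$ if $(\mathbf Y\perp\!\!\!\perp\mathbf Z\mid\mathbf X,\mathbf W)_{G_{\mathbf C_{\overline{\mathbf X}\,\overline{\mathbf Z(\mathbf W)}}}}$, where $\mathbf Z(\mathbf W)$ is the set of clusters in $\mathbf Z$ that are not ancestors of any cluster in $\mathbf W$ in $G_{\mathbf C_{\overline{\mathbf X}}}$. -/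

import Mathlib

/-- A graph with directed edges `a → b` and bidirected edges `a ↔ b`; a directed and a
bidirected edge between the same two vertices may coexist. -/
@[ext]
structure MixedGraph (V : Type*) where
  /-- `dir a b` means `a → b`, i.e. `a` is a parent of `b`. -/
  dir : V → V → Prop
  /-- `bidir a b` means `a ↔ b`. -/
  bidir : V → V → Prop
  bidir_symm : ∀ a b, bidir a b → bidir b a
  bidir_irrefl : ∀ a, ¬ bidir a a

/-- The three ways in which an edge can be traversed from `a` to `b`. -/
inductive EdgeKind
  /-- `a → b` -/
  | fwd
  /-- `a ← b` -/
  | bwd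
  /-- `a ↔ b` -/
  | bi

namespace EdgeKind

/-- There is an arrowhead at the first vertex, from which the edge is traversed. -/
def HeadAtSource : EdgeKind → Prop
  | fwd => False
  | bwd => True
  | bi => True

/-- There is an arrowhead at the second vertex, to which the edge is traversed. -/
def HeadAtTarget : EdgeKind → Prop
  | fwd => True
  | bwd => False
  | bi => True

end EdgeKind

namespace MixedGraph

variable {V : Type*}

/-- No directed cycles. A mixed graph with this property is an ADMG. -/
def Acyclic (G : MixedGraph V) : Prop := ∀ v, ¬ Relation.TransGen G.dir v v

/-- The set of (endogenous) parents of `v`. -/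
def parents (G : MixedGraph V) (v : V) : Set V := {p | G.dir p v}

/-- `a` is an ancestor of `b` along directed edges; every vertex is an ancestor of itself. -/
def IsAncestor (G : MixedGraph V) (a b : V) : Prop := Relation.ReflTransGen G.dir a b

/-- Remove all edges with an arrowhead into `X`. -/
def removeInto (G : MixedGraph V) (X : Set V) : MixedGraph V where
  dir a b := G.dir a b ∧ b ∉ X
  bidir a b := G.bidir a b ∧ a ∉ X ∧ b ∉ X
  bidir_symm a b h := ⟨G.bidir_symm a b h.1, h.2.2, h.2.1⟩
  bidir_irrefl a h := G.bidir_irrefl a h.1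

/-- Remove all edges with a tail at a vertex of `Z`. -/
def removeOutOf (G : MixedGraph V) (Z : Set V) : MixedGraph V where
  dir a b := G.dir a b ∧ a ∉ Z
  bidir := G.bidir
  bidir_symm := G.bidir_symm
  bidir_irrefl := G.bidir_irrefl

/-- The edge of kind `e` from `a` to `b` belongs to `G`. -/
def HasEdge (G : MixedGraph V) (a : V) (e : EdgeKind) (b : V) : Prop :=
  match e with
  | .fwd => G.dir a b
  | .bwd => G.dir b a
  | .bi => G.bidir a b

/-- `G.IsWalk a l b`: starting at `a`, the list `l` of pairs (edge, next vertex) is a walk in `G`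
that ends at `b`. -/
def IsWalk (G : MixedGraph V) : V → List (EdgeKind × V) → V → Prop
  | a, [], b => a = b
  | a, (e, c) :: l, b => G.HasEdge a e c ∧ G.IsWalk c l b

/-- A path is a walk without repeated vertices. -/
def IsPath (G : MixedGraph V) (a : V) (l : List (EdgeKind × V)) (b : V) : Prop :=
  G.IsWalk a l b ∧ (a :: l.map Prod.snd).Nodup

/-- The vertex `m`, between a traversed edge of kind `e` and the next one, of kind `e'`, is active
relative to `T`: it is a collider and it or one of its descendants is in `T`, or it is a
non-collider and is not in `T`. -/
def ActiveAt (G : MixedGraph V) (T : Set V) (e : EdgeKind) (m : V) (e' : EdgeKind) : Prop :=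
  ((e.HeadAtTarget ∧ e'.HeadAtSource) ∧ ∃ d ∈ T, G.IsAncestor m d) ∨
    (¬ (e.HeadAtTarget ∧ e'.HeadAtSource) ∧ m ∉ T)

/-- Every interior vertex of the walk is active relative to `T`. -/
def IsActive (G : MixedGraph V) (T : Set V) : List (EdgeKind × V) → Prop
  | (e, m) :: (e', b) :: l => G.ActiveAt T e m e' ∧ G.IsActive T ((e', b) :: l)
  | _ => True

/-- `(A ⫫ B ∣ T)_G`: no path between a vertex of `A` and a vertex of `B` is active given `T`. -/
def DSep (G : MixedGraph V) (A B T : Set V) : Prop :=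
  ∀ a ∈ A, ∀ b ∈ B, ∀ l, G.IsPath a l b → ¬ G.IsActive T l

/-- The graph over the clusters `c ⁻¹' {i}`, `i : C`, of the vertices of `G`: there is an edge
between two distinct clusters whenever `G` has such an edge between some of their members. -/
def clusterGraph {C : Type*} (G : MixedGraph V) (c : V → C) : MixedGraph C where
  dir i j := i ≠ j ∧ ∃ a b, c a = i ∧ c b = j ∧ G.dir a b
  bidir i j := i ≠ j ∧ ∃ a b, c a = i ∧ c b = j ∧ G.bidir a b
  bidir_symm := fun _ _ ⟨hne, a, b, ha, hb, h⟩ => ⟨hne.symm, b, a, hb, ha, G.bidir_symm a b h⟩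
  bidir_irrefl _ h := h.1 rfl

/-- `GC` is a C-DAG compatible with `G`, for the partition of the vertices of `G` into the
nonempty clusters `c ⁻¹' {i}`, `i : C`. -/
structure IsCompatibleCDAG {C : Type*} (GC : MixedGraph C) (G : MixedGraph V) (c : V → C) :
    Prop where
  surjective : Function.Surjective c
  eq_clusterGraph : GC = G.clusterGraph c
  acyclic : GC.Acyclic

/-- `Z(W)` relative to `G`: the vertices of `Z` that are not ancestors of any vertex of `W`. -/
def nonAncestors (G : MixedGraph V) (Z W : Set V) : Set V :=
  {z ∈ Z | ∀ w ∈ W, ¬ G.IsAncestor z w}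

/-- A system of mutually independent discrete latent variables `u j`, `j : J`, for the graph `G`,
with the conditional distributions `P(v_k ∣ pa_k, u_k)` of its vertices. -/
structure LatentModel (G : MixedGraph V) (S : V → Type*) (J : Type*) (L : J → Type*) where
  /-- The set `U_k` of latent parents of `k`. -/
  latentParents : V → Set J
  /-- Two vertices are joined by a bidirected edge iff they share a latent parent. -/
  bidir_iff : ∀ i k, i ≠ k → (G.bidir i k ↔ (latentParents i ∩ latentParents k).Nonempty)
  /-- The distribution of a latent variable. -/
  latentDist : ∀ j, PMF (L j)
  /-- `P(v_k ∣ pa_k, u_k)`. -/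
  condDist : ∀ k, (∀ p : G.parents k, S p) → (∀ j : latentParents k, L j) → PMF (S k)

open Classical in
/-- The right-hand side of the truncated factorization for `do(X = x)`, as a function of a full
assignment `v`, which gets mass `0` unless it is consistent with `x`:
`∑ u, P(u) * ∏ k ∉ X, P(v_k ∣ pa_k, u_k)`. -/
noncomputable def LatentModel.truncated [Fintype V] {G : MixedGraph V} {S : V → Type*} {J : Type*}
    [Fintype J] {L : J → Type*} (M : G.LatentModel S J L) (X : Set V) (x : ∀ i : X, S i)
    (v : ∀ i, S i) : ENNReal :=
  if ∀ i : X, v i = x i then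
    ∑' u : ∀ j, L j, (∏ j, M.latentDist j (u j)) *
      ∏ k ∈ Finset.univ.filter (fun k => k ∉ X),
        M.condDist k (fun p => v p) (fun j => u j) (v k)
  else 0

end MixedGraph

/-- A family of interventional distributions over variables with state spaces `S i`:
`P X x` is the joint distribution of all variables under `do(X = x)`. -/
abbrev InterventionalFamily {V : Type*} (S : V → Type*) :=
  (X : Set V) → (∀ i : X, S i) → PMF (∀ i, S i)

/-- `G` is a causal Bayesian network encoding the interventional distributions `P`: all of them
are given by the truncated factorization, with common latent variables and conditionals. -/
def MixedGraph.IsCBN {V : Type*} [Fintype V] (G : MixedGraph V) {S : V → Type*}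
    (P : InterventionalFamily S) : Prop :=
  ∃ (J : Type) (_ : Fintype J) (L : J → Type) (M : G.LatentModel S J L),
    ∀ (X : Set V) (x : ∀ i : X, S i) (v : ∀ i, S i), P X x v = M.truncated X x v

/-- `P(· ∣ do(x))`, where `x` is the restriction to `X` of the assignment `s`. -/
def InterventionalFamily.doDist {V : Type*} {S : V → Type*} (P : InterventionalFamily S)
    (X : Set V) (s : ∀ i, S i) : PMF (∀ i, S i) :=
  P X (fun i => s i)

/-- The probability under `μ` that the variables in `A` take their values in `s`. -/
noncomputable def PMF.probAt {V : Type*} {S : V → Type*} (μ : PMF (∀ i, S i)) (s : ∀ i, S i)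
    (A : Set V) : ENNReal :=
  μ.toOuterMeasure {v | ∀ i ∈ A, v i = s i}

/-- The conditional probability under `μ` that the variables in `A` take their values in `s`,
given that those in `B` do; meaningful if `μ.probAt s B ≠ 0`. -/
noncomputable def PMF.condProbAt {V : Type*} {S : V → Type*} (μ : PMF (∀ i, S i)) (s : ∀ i, S i)
    (A B : Set V) : ENNReal :=
  μ.probAt s (A ∪ B) / μ.probAt s B

/-! The joint law of the observed and latent variables is a product of conditional factors, and an
intervention merely deletes the factors of the intervened variables. Factors outside a suitable
ancestral set `D` of clusters sum to one, so only those of `D` matter.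

Let `K` be the set of clusters of `D` that are linked to `Z` by active walks (`linked`). It contains
the part of `Z` in `D`, d-separation keeps `Y` out of it, and it is closed under adjacency in `D`
except through fixed variables. The factors of `K` therefore share only fixed variables with the
other ones, and the sum over assignments splits into a part from `K` and a remainder
(`sumAgreeing_weight_split`). The part from `K` is the same in the numerator and the denominator of
the conditional probability of `Y` and cancels (`sumAgreeing_weight_div`). The remainder cannot tell
whether `Z` is intervened on, observed or summed out, so both sides of each rule equal one and the
same number (`exists_condProbAt_doDist_eq`).

Walks live in the cluster graph and factors in `G`. The two fit together because all variables of a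
cluster fall on the same side of the split, and a latent variable shared by two clusters is a
bidirected edge between them. Hence no d-separation in `G` has to be derived. Acyclicity of the
cluster graph is needed to shorten active walks to active paths (`exists_isPath_of_isActive`). -/

namespace MixedGraph

/-! ### Active walks, and the vertices they link to a set -/

section ActiveWalks

variable {V : Type*} {H : MixedGraph V} {T : Set V}

theorem IsActive.tail {p : EdgeKind × V} {l : List (EdgeKind × V)} (h : H.IsActive T (p :: l)) :
    H.IsActive T l := by
  obtain ⟨e, m⟩ := p
  cases l with
  | nil => trivial
  | cons q l => exact h.2

theorem IsActive.of_append {l₁ l₂ : List (EdgeKind × V)} (h : H.IsActive T (l₁ ++ l₂)) :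
    H.IsActive T l₂ := by
  induction l₁ with
  | nil => exact h
  | cons p l ih => exact ih (IsActive.tail h)

theorem isWalk_append {a b : V} {l₁ l₂ : List (EdgeKind × V)} :
    H.IsWalk a (l₁ ++ l₂) b ↔ ∃ m, H.IsWalk a l₁ m ∧ H.IsWalk m l₂ b := by
  induction l₁ generalizing a with
  | nil => simp [IsWalk]
  | cons p l ih => simp [IsWalk, ih, and_assoc]

/-- A walk that starts with an arrow `→ x` either is directed up to `y` or meets a collider. -/
theorem isAncestor_of_isActive_fwd {x y : V} {l r : List (EdgeKind × V)} (hl : H.IsWalk x l y)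
    (h : H.IsActive T ((.fwd, x) :: l ++ r)) :
    (∃ d ∈ T, H.IsAncestor x d) ∨ H.IsAncestor x y := by
  induction l generalizing x with
  | nil => exact .inr (by rw [show x = y from hl]; exact .refl)
  | cons p l ih =>
    obtain ⟨e, c⟩ := p
    obtain ⟨he, hl⟩ := hl
    obtain ⟨hx, h⟩ := h
    cases e with
    | fwd =>
      rcases ih hl h with ⟨d, hd, hcd⟩ | hcy
      · exact .inl ⟨d, hd, .head he hcd⟩
      · exact .inr (.head he hcy)
    | bwd => simpa [ActiveAt, EdgeKind.HeadAtTarget, EdgeKind.HeadAtSource] using Or.inl hx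
    | bi =>
      left
      simpa [ActiveAt, EdgeKind.HeadAtTarget, EdgeKind.HeadAtSource] using hx

/-- A closed walk can be cut out of an active walk. -/
theorem IsActive.cut (hH : H.Acyclic) {e₀ e : EdgeKind} {a : V} {l₁ l₂ : List (EdgeKind × V)}
    (hl : H.IsWalk a (l₁ ++ [(e, a)]) a)
    (h : H.IsActive T ((e₀, a) :: (l₁ ++ (e, a) :: l₂))) : H.IsActive T ((e₀, a) :: l₂) := by
  cases l₂ with
  | nil => trivial
  | cons p l₃ =>
    obtain ⟨e₂, d⟩ := p
    have h2 : H.IsActive T ((e, a) :: (e₂, d) :: l₃) :=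
      IsActive.of_append (l₁ := (e₀, a) :: l₁) h
    refine ⟨?_, h2.2⟩
    obtain ⟨e₁, x, l, hl'⟩ : ∃ e₁ x l, l₁ ++ [(e, a)] = (e₁, x) :: l := by
      cases l₁ with
      | nil => exact ⟨e, a, [], rfl⟩
      | cons p l => exact ⟨p.1, p.2, l ++ [(e, a)], rfl⟩
    have h1 : H.IsActive T ((e₀, a) :: (e₁, x) :: (l ++ (e₂, d) :: l₃)) := by
      have : (e₁, x) :: (l ++ (e₂, d) :: l₃) = l₁ ++ (e, a) :: (e₂, d) :: l₃ := by
        rw [← List.cons_append, ← hl']; simp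
      rw [this]; exact h
    rw [hl'] at hl
    -- If `a` becomes a collider, either it was one on entering the closed walk, or that walk leaves
    -- `a` by an arrow; it cannot be directed all the way back to `a`, so it meets a collider below
    -- `a` that has a descendant in `T`.
    by_cases hc : e₀.HeadAtTarget ∧ e₂.HeadAtSource
    · refine .inl ⟨hc, ?_⟩
      by_cases he₁ : e₁.HeadAtSource
      · rcases h1.1 with h | h
        · exact h.2
        · exact absurd ⟨hc.1, he₁⟩ h.1
      · have : e₁ = .fwd := by
          cases e₁ <;> simp_all [EdgeKind.HeadAtSource]
        subst this
        rcases isAncestor_of_isActive_fwd hl.2 (r := (e₂, d) :: l₃) h1.2 with ⟨t, ht, hxt⟩ | hxa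
        · exact ⟨t, ht, .head hl.1 hxt⟩
        · exact absurd (Relation.TransGen.head' (show H.dir a x from hl.1) hxa) (hH a)
    -- If `a ∈ T`, both old junctions at `a` were colliders, so both outer edges have arrowheads at
    -- `a`.
    · refine .inr ⟨hc, fun haT => hc ⟨?_, ?_⟩⟩
      · rcases h1.1 with h | h
        · exact h.1.1
        · exact absurd haT h.2
      · rcases h2.1 with h | h
        · exact h.1.2
        · exact absurd haT h.2

theorem exists_append_of_mem_map_snd {a : V} {l : List (EdgeKind × V)} (h : a ∈ l.map Prod.snd) :
    ∃ l₁ e l₂, l = l₁ ++ (e, a) :: l₂ := by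
  obtain ⟨⟨e, b⟩, hp, rfl⟩ := List.mem_map.1 h
  obtain ⟨l₁, l₂, rfl⟩ := List.append_of_mem hp
  exact ⟨l₁, e, l₂, rfl⟩

theorem IsWalk.split_at {a b z : V} {e : EdgeKind} {l₁ l₂ : List (EdgeKind × V)}
    (h : H.IsWalk a (l₁ ++ (e, b) :: l₂) z) :
    H.IsWalk a (l₁ ++ [(e, b)]) b ∧ H.IsWalk b l₂ z := by
  obtain ⟨m, h1, h2⟩ := isWalk_append.1 h
  exact ⟨isWalk_append.2 ⟨m, h1, h2.1, rfl⟩, h2.2⟩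

/-- Carrying the incoming edge `e₀` through the induction keeps track of the activity of `a`, which
depends on both adjacent edges. The inclusion of vertices preserves the absence of repetitions when
an edge is put back in front. -/
theorem exists_isPath_of_isActive_cons (hH : H.Acyclic) (e₀ : EdgeKind) {a z : V}
    (l : List (EdgeKind × V)) (hl : H.IsWalk a l z) (h : H.IsActive T ((e₀, a) :: l)) :
    ∃ l', H.IsPath a l' z ∧ H.IsActive T ((e₀, a) :: l') ∧
      ∀ v ∈ l'.map Prod.snd, v ∈ l.map Prod.snd := by
  induction hn : l.length using Nat.strong_induction_on generalizing e₀ a l with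
  | _ n ih =>
    subst hn
    by_cases ha : a ∈ l.map Prod.snd
    · obtain ⟨l₁, e, l₂, rfl⟩ := exists_append_of_mem_map_snd ha
      obtain ⟨h1, h2⟩ := hl.split_at
      obtain ⟨l', hp, hact, hsub⟩ := ih l₂.length (by simp; omega) e₀ l₂ h2 (h.cut hH h1) rfl
      refine ⟨l', hp, hact, fun v hv => ?_⟩
      have := hsub v hv
      simp only [List.map_append, List.map_cons, List.mem_append, List.mem_cons]
      exact .inr (.inr this)
    · cases l with
      | nil => exact ⟨[], ⟨hl, by simp⟩, trivial, by simp⟩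
      | cons p l =>
        obtain ⟨e, c⟩ := p
        obtain ⟨l', hp, hact, hsub⟩ := ih l.length (by simp) e l hl.2 h.2 rfl
        have hsub' : ∀ v ∈ c :: l'.map Prod.snd, v ∈ c :: l.map Prod.snd := by
          intro v hv
          rcases List.mem_cons.1 hv with rfl | hv
          · simp
          · exact List.mem_cons_of_mem _ (hsub v hv)
        refine ⟨(e, c) :: l', ⟨⟨hl.1, hp.1⟩, ?_⟩, ⟨h.1, hact⟩, hsub'⟩
        exact List.nodup_cons.2 ⟨fun hm => ha (hsub' a hm), hp.2⟩

/-- An active walk yields an active path. -/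
theorem exists_isPath_of_isActive (hH : H.Acyclic) {a z : V} (l : List (EdgeKind × V))
    (hl : H.IsWalk a l z) (h : H.IsActive T l) : ∃ l', H.IsPath a l' z ∧ H.IsActive T l' := by
  induction hn : l.length using Nat.strong_induction_on generalizing l with
  | _ n ih =>
    subst hn
    by_cases ha : a ∈ l.map Prod.snd
    · obtain ⟨l₁, e, l₂, rfl⟩ := exists_append_of_mem_map_snd ha
      -- Endpoints carry no activity condition, so a return to the starting vertex is cut off
      -- without checking a junction.
      exact ih l₂.length (by simp; omega) l₂ hl.split_at.2
        (IsActive.of_append (l₁ := l₁ ++ [(e, a)]) (by simpa using h)) rfl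
    · cases l with
      | nil => exact ⟨[], ⟨hl, by simp⟩, trivial⟩
      | cons p l =>
        obtain ⟨e, c⟩ := p
        obtain ⟨l', hp, hact, hsub⟩ := exists_isPath_of_isActive_cons hH e l hl.2 h
        refine ⟨(e, c) :: l', ⟨⟨hl.1, hp.1⟩, List.nodup_cons.2 ⟨fun hm => ha ?_, hp.2⟩⟩, hact⟩
        rcases List.mem_cons.1 hm with rfl | hm
        · simp
        · exact List.mem_cons_of_mem _ (hsub a hm)

/-- The list `l` is an active walk from `a` to a vertex of `B`. -/
def IsActiveWalkTo (H : MixedGraph V) (T B : Set V) (a : V) (l : List (EdgeKind × V)) : Prop :=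
  ∃ b ∈ B, H.IsWalk a l b ∧ H.IsActive T l

/-- Some active walk from `a` to `B` starts with an edge that has an arrowhead at `a`. -/
def HeadReaches (H : MixedGraph V) (T B : Set V) (a : V) : Prop :=
  ∃ e c l, H.IsActiveWalkTo T B a ((e, c) :: l) ∧ e.HeadAtSource

/-- Some active walk from `a` to `B` is trivial or starts with an edge without arrowhead at `a`. -/
def TailReaches (H : MixedGraph V) (T B : Set V) (a : V) : Prop :=
  ∃ l, H.IsActiveWalkTo T B a l ∧ ∀ p ∈ l.head?, ¬ EdgeKind.HeadAtSource p.1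

variable {A B : Set V}

theorem IsActiveWalkTo.cons {a c : V} {e : EdgeKind} {l : List (EdgeKind × V)}
    (h : H.IsActiveWalkTo T B c l) (he : H.HasEdge a e c)
    (hc : ∀ p ∈ l.head?, H.ActiveAt T e c p.1) : H.IsActiveWalkTo T B a ((e, c) :: l) := by
  obtain ⟨b, hb, hl, hact⟩ := h
  refine ⟨b, hb, ⟨he, hl⟩, ?_⟩
  cases l with
  | nil => trivial
  | cons p l => exact ⟨hc p (by simp), hact⟩

theorem DSep.not_isActiveWalkTo (hH : H.Acyclic) (h : H.DSep A B T) {a : V} (ha : a ∈ A)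
    (l : List (EdgeKind × V)) : ¬ H.IsActiveWalkTo T B a l := by
  rintro ⟨b, hb, hl, hact⟩
  obtain ⟨l', hp, hact'⟩ := exists_isPath_of_isActive hH l hl hact
  exact h a ha b hb l' hp hact'

theorem TailReaches.refl {b : V} (hb : b ∈ B) : H.TailReaches T B b :=
  ⟨[], ⟨b, hb, rfl, trivial⟩, by simp⟩

/-- From a non-ancestor of `T`, an active walk can be prolonged backwards to any descendant. -/
theorem exists_isActiveWalkTo_of_isAncestor {i y : V} (hiy : H.IsAncestor i y)
    (hi : ¬ ∃ d ∈ T, H.IsAncestor i d) (h : ∃ l, H.IsActiveWalkTo T B i l) :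
    ∃ l, H.IsActiveWalkTo T B y l := by
  induction hiy using Relation.ReflTransGen.head_induction_on with
  | refl => exact h
  | @head i j hij _ ih =>
    obtain ⟨l, hl⟩ := h
    refine ih (fun ⟨d, hd, hjd⟩ => hi ⟨d, hd, .head hij hjd⟩) ⟨(.bwd, i) :: l, hl.cons (e := .bwd) hij ?_⟩
    exact fun p _ => .inr ⟨fun hc => hc.1, fun hT => hi ⟨i, hT, .refl⟩⟩

theorem TailReaches.of_isAncestor {i b : V} (hb : b ∈ B) (hib : H.IsAncestor i b)
    (hi : ¬ ∃ d ∈ T, H.IsAncestor i d) : H.TailReaches T B i := by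
  induction hib using Relation.ReflTransGen.head_induction_on with
  | refl => exact .refl hb
  | @head i j hij _ ih =>
    have hj : ¬ ∃ d ∈ T, H.IsAncestor j d := fun ⟨d, hd, hjd⟩ => hi ⟨d, hd, .head hij hjd⟩
    obtain ⟨l, hl, hp⟩ := ih hj
    refine ⟨(.fwd, j) :: l, hl.cons (e := .fwd) hij fun p hpl => ?_, by simp [EdgeKind.HeadAtSource]⟩
    exact .inr ⟨fun hc => hp p hpl hc.2, fun hT => hj ⟨j, hT, .refl⟩⟩

/-- The vertices of `D` whose conditional distributions are linked to those of `B` given `T`. -/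
def linked (H : MixedGraph V) (T B D : Set V) : Set V :=
  {i ∈ D | H.HeadReaches T B i ∨ i ∉ T ∧ H.TailReaches T B i}

variable {D : Set V} {i j : V}

theorem exists_isActiveWalkTo_of_mem_linked (hi : i ∈ H.linked T B D) :
    ∃ l, H.IsActiveWalkTo T B i l := by
  rcases hi.2 with ⟨e, c, l, hl, -⟩ | ⟨-, l, hl, -⟩
  exacts [⟨_, hl⟩, ⟨l, hl⟩]

theorem mem_linked_of_mem (hBT : Disjoint B T) (hi : i ∈ B) (hD : i ∈ D) : i ∈ H.linked T B D :=
  ⟨hD, .inr ⟨Set.disjoint_left.1 hBT hi, .refl hi⟩⟩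

theorem not_mem_of_mem_linked (hH : H.Acyclic) (h : H.DSep A B T) (hi : i ∈ H.linked T B D) :
    i ∉ A := fun hA => by
  obtain ⟨l, hl⟩ := exists_isActiveWalkTo_of_mem_linked hi
  exact h.not_isActiveWalkTo hH hA l hl

/-- An edge into a linked vertex prolongs an active walk. -/
theorem exists_isActiveWalkTo_cons_of_mem_linked (hH : H.Acyclic) (h : H.DSep A B T)
    (hD : ∀ i ∈ D, ∃ d ∈ A ∪ B ∪ T, H.IsAncestor i d) (hi : i ∈ H.linked T B D)
    {e : EdgeKind} (he : H.HasEdge j e i) (het : e.HeadAtTarget) :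
    ∃ l, H.IsActiveWalkTo T B j ((e, i) :: l) := by
  -- The new edge points at `i`, so its continuation must either open a collider at `i` or leave `i
  -- ∉ T` by a tail. If there is only a head continuation and `i` has no descendant in `T`, then by
  -- `hD` it is an ancestor of `A`, against d-separation, or of `B`, which gives a directed walk.
  have key : (∃ d ∈ T, H.IsAncestor i d) ∧ H.HeadReaches T B i ∨
      i ∉ T ∧ H.TailReaches T B i := by
    rcases hi.2 with hh | ht
    · by_cases hT : ∃ d ∈ T, H.IsAncestor i d
      · exact .inl ⟨hT, hh⟩
      · refine .inr ⟨fun hiT => hT ⟨i, hiT, .refl⟩, ?_⟩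
        obtain ⟨d, (hd | hd) | hd, hid⟩ := hD i hi.1
        · obtain ⟨l, hl⟩ := exists_isActiveWalkTo_of_isAncestor hid hT
            (exists_isActiveWalkTo_of_mem_linked hi)
          exact absurd hl (h.not_isActiveWalkTo hH hd l)
        · exact .of_isAncestor hd hid hT
        · exact absurd ⟨d, hd, hid⟩ hT
    · exact .inr ht
  rcases key with ⟨hT, e', c, l, hl, he'⟩ | ⟨hT, l, hl, hp⟩
  · refine ⟨_, hl.cons he ?_⟩
    rintro p hp
    simp only [List.head?_cons, Option.mem_def, Option.some.injEq] at hp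
    subst hp
    exact .inl ⟨⟨het, he'⟩, hT⟩
  · exact ⟨_, hl.cons he fun p hpl => .inr ⟨fun hc => hp p hpl hc.2, hT⟩⟩

theorem mem_linked_of_bidir (hH : H.Acyclic) (h : H.DSep A B T)
    (hD : ∀ i ∈ D, ∃ d ∈ A ∪ B ∪ T, H.IsAncestor i d) (hi : i ∈ H.linked T B D)
    (hij : H.bidir i j) (hj : j ∈ D) : j ∈ H.linked T B D := by
  obtain ⟨l, hl⟩ := exists_isActiveWalkTo_cons_of_mem_linked hH h hD hi (e := .bi)
    (H.bidir_symm _ _ hij) trivial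
  exact ⟨hj, .inl ⟨_, _, _, hl, trivial⟩⟩

/-- The prolonged walk leaves `j` by a tail, which links `j` only if it is not conditioned on. A
parent in `T` is a fixed variable, and sharing it does not link factors. -/
theorem mem_linked_of_dir_left (hH : H.Acyclic) (h : H.DSep A B T)
    (hD : ∀ i ∈ D, ∃ d ∈ A ∪ B ∪ T, H.IsAncestor i d) (hi : i ∈ H.linked T B D)
    (hji : H.dir j i) (hj : j ∈ D) (hjT : j ∉ T) : j ∈ H.linked T B D := by
  obtain ⟨l, hl⟩ := exists_isActiveWalkTo_cons_of_mem_linked hH h hD hi (e := .fwd) hji trivial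
  exact ⟨hj, .inr ⟨hjT, _, hl, by simp [EdgeKind.HeadAtSource]⟩⟩

/-- The tail at `i` makes it a non-collider however the walk continues, so neither d-separation nor
ancestry is needed. -/
theorem mem_linked_of_dir_right (hi : i ∈ H.linked T B D) (hij : H.dir i j) (hj : j ∈ D)
    (hiT : i ∉ T) : j ∈ H.linked T B D := by
  obtain ⟨l, hl⟩ := exists_isActiveWalkTo_of_mem_linked hi
  exact ⟨hj, .inl ⟨.bwd, i, l, hl.cons (e := .bwd) hij fun p _ => .inr ⟨fun hc => hc.1, hiT⟩, trivial⟩⟩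

end ActiveWalks

end MixedGraph

/-! ### Sums of products of conditional factors -/

section Factorization

open Set Function

variable {ι : Type*} {T : ι → Type*}

/-- The sum of `F` over all assignments that agree with `s` on `E`. -/
noncomputable def sumAgreeing (s : ∀ i, T i) (E : Set ι) (F : (∀ i, T i) → ENNReal) : ENNReal :=
  ∑' w : {w : ∀ i, T i // ∀ i ∈ E, w i = s i}, F w

open Classical in
/-- An assignment that agrees with `s` on `E` consists of its values outside and inside of `A`. -/
noncomputable def agreeingEquiv (s : ∀ i, T i) (E A : Set ι) :
    {w : ∀ i, T i // ∀ i ∈ E ∪ A, w i = s i} × {w : ∀ i, T i // ∀ i ∈ E ∪ Aᶜ, w i = s i} ≃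
      {w : ∀ i, T i // ∀ i ∈ E, w i = s i} where
  toFun p := ⟨A.piecewise p.2.1 p.1.1, fun i hi => by
    by_cases h : i ∈ A
    · simpa [h] using p.2.2 i (.inl hi)
    · simpa [h] using p.1.2 i (.inl hi)⟩
  invFun w := (⟨A.piecewise s w.1, fun i hi => by
      by_cases h : i ∈ A
      · simp [h]
      · simpa [h] using w.2 i (hi.resolve_right h)⟩,
    ⟨A.piecewise w.1 s, fun i hi => by
      by_cases h : i ∈ A
      · simpa [h] using w.2 i (hi.resolve_right (fun h' => h' h))
      · simp [h]⟩)
  left_inv p := by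
    ext i
    · by_cases h : i ∈ A
      · simpa [h] using (p.1.2 i (.inr h)).symm
      · simp [h]
    · by_cases h : i ∈ A
      · simp [h]
      · simpa [h] using (p.2.2 i (.inr h)).symm
  right_inv w := by
    ext i
    by_cases h : i ∈ A <;> simp [h]

open Classical in
theorem sumAgreeing_eq_tsum_tsum (s : ∀ i, T i) (E A : Set ι) (F : (∀ i, T i) → ENNReal) :
    sumAgreeing s E F = ∑' (w₂ : {w : ∀ i, T i // ∀ i ∈ E ∪ A, w i = s i})
      (w₁ : {w : ∀ i, T i // ∀ i ∈ E ∪ Aᶜ, w i = s i}), F (A.piecewise w₁.1 w₂.1) := by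
  rw [sumAgreeing, ← (agreeingEquiv s E A).tsum_eq, ENNReal.tsum_prod']
  rfl

/-- Once the shared variables are fixed, each free variable is seen by at most one factor, and
distributivity applies. In each sum the variables assigned to the other factor are frozen at `s`, so
that nothing is counted twice. -/
theorem sumAgreeing_mul (s : ∀ i, T i) {E A B : Set ι} {g h : (∀ i, T i) → ENNReal}
    (hg : DependsOn g A) (hh : DependsOn h B) (hAB : A ∩ B ⊆ E) :
    sumAgreeing s E (fun w => g w * h w) = sumAgreeing s (E ∪ Aᶜ) g * sumAgreeing s (E ∪ A) h := by
  classical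
  rw [sumAgreeing_eq_tsum_tsum s E A, mul_comm]
  simp only [sumAgreeing]
  rw [← ENNReal.tsum_mul_right]
  refine tsum_congr fun w₂ => ?_
  rw [← ENNReal.tsum_mul_left]
  refine tsum_congr fun w₁ => ?_
  rw [mul_comm]
  congr 1
  · refine hh fun i hi => ?_
    by_cases hA : i ∈ A
    · rw [piecewise_eq_of_mem _ _ _ hA, w₁.2 i (.inl (hAB ⟨hA, hi⟩)), w₂.2 i (.inr hA)]
    · simp [hA]
  · exact hg fun i hi => by simp [hi]

theorem sumAgreeing_mul_of_tsum_update_eq_one [DecidableEq ι] (s : ∀ i, T i) {E : Set ι} {k : ι}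
    (hk : k ∉ E) {g h : (∀ i, T i) → ENNReal} (hg : DependsOn g {k}ᶜ)
    (hh : ∀ w, ∑' x, h (update w k x) = 1) :
    sumAgreeing s E (fun w => g w * h w) = sumAgreeing s (E ∪ {k}) g := by
  classical
  let e : T k ≃ {w : ∀ i, T i // ∀ i ∈ E ∪ {k}ᶜ, w i = s i} :=
    { toFun := fun x => ⟨update s k x, fun i hi => by
        have : i ≠ k := by
          rintro rfl
          exact hi.elim hk (fun h => h rfl)
        simp [this]⟩
      invFun := fun w => w.1 k
      left_inv := fun x => by simp
      right_inv := fun w => by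
        ext i
        by_cases h : i = k
        · subst h; simp
        · simpa [h] using (w.2 i (.inr h)).symm }
  rw [sumAgreeing_eq_tsum_tsum s E {k}]
  simp only [sumAgreeing]
  refine tsum_congr fun w₂ => ?_
  have hp : ∀ [∀ i, Decidable (i ∈ ({k} : Set ι))] x, ({k} : Set ι).piecewise (e x).1 w₂.1 = update w₂.1 k x := by
    intro _ x
    ext i
    by_cases h : i = k
    · subst h; simp [e]
    · simp [h]
  rw [← e.tsum_eq]
  simp only [hp]
  have hg' : ∀ x, g (update w₂.1 k x) = g w₂.1 := fun x => hg fun i hi => by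
    rw [update_of_ne hi]
  simp only [hg']
  rw [ENNReal.tsum_mul_left, hh, mul_one]

variable [Fintype ι]

/-- The product of the factors `f k`, `k ∈ N`. -/
noncomputable def weight (f : ι → (∀ i, T i) → ENNReal) (N : Set ι) (w : ∀ i, T i) : ENNReal :=
  ∏ k, N.mulIndicator (fun k => f k w) k

/-- The variables on which the factors `f k`, `k ∈ N`, depend. -/
def scope (par : ι → Set ι) (N : Set ι) : Set ι := {i | ∃ k ∈ N, i ∈ insert k (par k)}

/-- The factors `f k` are conditional distributions of the variables `k` given their parents, for
an acyclic parent relation. -/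
structure IsFactorization (par : ι → Set ι) (f : ι → (∀ i, T i) → ENNReal) : Prop where
  dependsOn : ∀ k, DependsOn (f k) (insert k (par k))
  tsum_update : ∀ [DecidableEq ι] (k : ι) (w : ∀ i, T i), ∑' x, f k (update w k x) = 1
  acyclic : ∀ k, ¬ Relation.TransGen (fun a b => a ∈ par b) k k

variable {par : ι → Set ι} {f : ι → (∀ i, T i) → ENNReal}

theorem weight_union {N R : Set ι} (h : Disjoint N R) (w : ∀ i, T i) :
    weight f (N ∪ R) w = weight f N w * weight f R w := by
  rw [weight, Set.mulIndicator_union_of_disjoint h]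
  simp only [Finset.prod_mul_distrib, weight]

theorem weight_singleton (k : ι) (w : ∀ i, T i) : weight f {k} w = f k w := by
  classical
  rw [weight, Finset.prod_eq_single k (fun b _ hb => by simp [hb]) (by simp)]
  simp

namespace IsFactorization

variable (hf : IsFactorization par f)
include hf

theorem dependsOn_weight (N : Set ι) : DependsOn (weight f N) (scope par N) := by
  intro w w' h
  refine Finset.prod_congr rfl fun k _ => ?_
  by_cases hk : k ∈ N
  · simp only [mulIndicator_of_mem hk]
    exact hf.dependsOn k fun i hi => h i ⟨k, hk, hi⟩
  · simp only [mulIndicator_of_notMem hk]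

theorem exists_childless {R : Set ι} (hR : R.Nonempty) : ∃ k ∈ R, ∀ i ∈ R, k ∉ par i := by
  let r : ι → ι → Prop := fun a b => Relation.TransGen (fun a b => a ∈ par b) b a
  have : IsTrans ι r := ⟨fun a b c hab hbc => hbc.trans hab⟩
  have : Std.Irrefl r := ⟨hf.acyclic⟩
  obtain ⟨k, hk, hmin⟩ := (Finite.wellFounded_of_trans_of_irrefl r).has_min R hR
  exact ⟨k, hk, fun i hi hki => hmin i hi (.single hki)⟩

/-- Variables without children in `N` can be summed out. -/
theorem sumAgreeing_weight_union (s : ∀ i, T i) {E N R : Set ι} (hNR : Disjoint N R)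
    (hER : Disjoint E R) (hpar : ∀ k ∈ N, Disjoint (par k) R) :
    sumAgreeing s E (weight f (N ∪ R)) = sumAgreeing s (E ∪ R) (weight f N) := by
  classical
  induction hn : R.ncard generalizing E R with
  | zero =>
    rw [Set.ncard_eq_zero] at hn
    simp [hn]
  | succ n ih =>
    have hne : R.Nonempty := by
      rw [← Set.ncard_pos]; omega
    -- No factor but its own involves such a `k`, so it sums to one and `k` may be frozen at its
    -- value in `s`.
    obtain ⟨k, hk, hmin⟩ := hf.exists_childless hne
    obtain ⟨R', hR', rfl⟩ : ∃ R', k ∉ R' ∧ R = R' ∪ {k} :=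
      ⟨R \ {k}, by simp, by simp [Set.union_singleton, Set.insert_eq_of_mem hk]⟩
    rw [Set.disjoint_union_right] at hNR hER
    have hkN : k ∉ N := Set.disjoint_singleton_right.1 hNR.2
    have hkE : k ∉ E := Set.disjoint_singleton_right.1 hER.2
    have hd : Disjoint (N ∪ R') {k} := by simp [hkN, hR']
    have hscope : scope par (N ∪ R') ⊆ {k}ᶜ := by
      rintro _ ⟨i, hi, hki⟩ rfl
      rcases hki with rfl | hki
      · exact hi.elim hkN hR'
      · rcases hi with hi | hi
        · exact Set.disjoint_left.1 (hpar i hi) hki (.inr rfl)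
        · exact hmin i (.inl hi) hki
    have hw : weight f (N ∪ (R' ∪ {k})) = fun w => weight f (N ∪ R') w * f k w := by
      funext w
      rw [← Set.union_assoc, weight_union hd, weight_singleton]
    rw [hw, sumAgreeing_mul_of_tsum_update_eq_one s hkE
      ((hf.dependsOn_weight _).mono hscope) (fun w => hf.tsum_update k w),
      ih hNR.1 (by simp [hER.1, hR']) (fun i hi => (hpar i hi).mono_right subset_union_left)]
    · congr 1
      rw [Set.union_assoc, Set.union_comm {k}]
    · rw [Set.union_singleton, Set.ncard_insert_of_notMem hR'] at hn
      omega

/-- The cut is made along the scope of `K` rather than that of `N`: interventions change which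
factors `N` of `K` survive, and the second sum must not depend on this. -/
theorem sumAgreeing_weight_split (s : ∀ i, T i) {E N R K : Set ι} (hN : N ⊆ K)
    (hNR : Disjoint N R) (hE : scope par K ∩ scope par R ⊆ E) :
    sumAgreeing s E (weight f (N ∪ R)) =
      sumAgreeing s (E ∪ (scope par K)ᶜ) (weight f N) *
        sumAgreeing s (E ∪ scope par K) (weight f R) := by
  have hw : weight f (N ∪ R) = fun w => weight f N w * weight f R w :=
    funext fun w => weight_union hNR w
  rw [hw]
  refine sumAgreeing_mul s ((hf.dependsOn_weight N).mono ?_) (hf.dependsOn_weight R) hE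
  rintro i ⟨k, hk, hi⟩
  exact ⟨k, hN hk, hi⟩

/-- Factors that share only fixed variables with the other ones, and do not depend on `Y`, do not
contribute to the conditional distribution of `Y`. -/
theorem sumAgreeing_weight_div (s : ∀ i, T i) {E N R K Y : Set ι} (hN : N ⊆ K)
    (hNR : Disjoint N R) (hE : scope par K ∩ scope par R ⊆ E) (hY : Disjoint Y (scope par K))
    (h0 : sumAgreeing s E (weight f (N ∪ R)) ≠ 0) (htop : sumAgreeing s E (weight f (N ∪ R)) ≠ ⊤) :
    sumAgreeing s (Y ∪ E) (weight f (N ∪ R)) / sumAgreeing s E (weight f (N ∪ R)) =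
      sumAgreeing s (Y ∪ (E ∪ scope par K)) (weight f R) /
        sumAgreeing s (E ∪ scope par K) (weight f R) := by
  have hYE : Y ∪ E ∪ (scope par K)ᶜ = E ∪ (scope par K)ᶜ := by
    have : Y ⊆ (scope par K)ᶜ := Set.disjoint_left.1 hY
    rw [Set.union_comm Y, Set.union_assoc, Set.union_eq_self_of_subset_left this]
  rw [hf.sumAgreeing_weight_split s hN hNR (hE.trans subset_union_right), hYE]
  rw [hf.sumAgreeing_weight_split s hN hNR hE] at h0 htop ⊢
  rw [ENNReal.mul_div_mul_left _ _ (left_ne_zero_of_mul h0), Set.union_assoc]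
  intro h
  rw [h, ENNReal.top_mul (right_ne_zero_of_mul h0)] at htop
  exact htop rfl

end IsFactorization

end Factorization

/-! ### The latent variable model as a factorization -/

section Model

open Set Function

universe u

variable {V : Type*} {S : V → Type u} {J : Type*} {L : J → Type}

namespace MixedGraph.LatentModel

variable {G : MixedGraph V} (M : G.LatentModel S J L)

/-- The state spaces of the observed and the latent variables. -/
abbrev State (S : V → Type u) (L : J → Type) : V ⊕ J → Type u :=
  Sum.elim S fun j => ULift.{u} (L j)

/-- The observed and latent parents of the observed and latent variables. -/
def par : V ⊕ J → Set (V ⊕ J)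
  | .inl k => Sum.inl '' G.parents k ∪ Sum.inr '' M.latentParents k
  | .inr _ => ∅

/-- The conditional distributions of the observed and latent variables. -/
noncomputable def factor : V ⊕ J → (∀ i, State S L i) → ENNReal
  | .inl k, w => M.condDist k (fun p => w (.inl p.1)) (fun j => (w (.inr j.1)).down) (w (.inl k))
  | .inr j, w => M.latentDist j (w (.inr j)).down

/-- Latent variables have no parents, so a chain of parents can only start at one; a cycle would be
a directed cycle of `G`. -/
theorem exists_inl_of_transGen {x y : V ⊕ J}
    (h : Relation.TransGen (fun a b => a ∈ M.par b) x y) :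
    ∃ b, y = .inl b ∧ ∀ a, x = .inl a → Relation.TransGen G.dir a b := by
  induction h with
  | @single y h =>
    rcases y with b | j
    · refine ⟨b, rfl, ?_⟩
      rintro a rfl
      refine .single ?_
      simpa [par, parents] using h
    · exact h.elim
  | @tail z y _ h ih =>
    obtain ⟨c, rfl, ih⟩ := ih
    rcases y with b | j
    · refine ⟨b, rfl, ?_⟩
      rintro a rfl
      refine (ih a rfl).tail ?_
      simpa [par, parents] using h
    · exact h.elim

theorem isFactorization (hG : G.Acyclic) : IsFactorization M.par M.factor where
  dependsOn := by
    rintro (k | j) w w' h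
    · have h1 : ∀ p : G.parents k, w (.inl p.1) = w' (.inl p.1) := fun p =>
        h _ (.inr (.inl ⟨p, p.2, rfl⟩))
      have h2 : ∀ j : M.latentParents k, w (.inr j.1) = w' (.inr j.1) := fun j =>
        h _ (.inr (.inr ⟨j, j.2, rfl⟩))
      have h3 : w (.inl k) = w' (.inl k) := h _ (.inl rfl)
      simp only [factor, h1, h2, h3]
    · have h3 : w (.inr j) = w' (.inr j) := h _ (.inl rfl)
      simp only [factor, h3]
  tsum_update := by
    rintro _ (k | j) w
    · have h1 : ∀ x, ∀ p : G.parents k, update w (.inl k) x (.inl p.1) = w (.inl p.1) := by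
        intro x p
        refine update_of_ne (fun h => ?_) _ _
        have hp : G.dir p.1 k := p.2
        rw [Sum.inl_injective h] at hp
        exact hG k (.single hp)
      have h2 : ∀ x, ∀ j : M.latentParents k, update w (.inl k) x (.inr j.1) = w (.inr j.1) :=
        fun x j => update_of_ne (by simp) _ _
      simp only [factor, h1, h2, update_self]
      exact PMF.tsum_coe _
    · simp only [factor, update_self]
      exact (Equiv.ulift.tsum_eq (M.latentDist j)).trans (PMF.tsum_coe _)
  acyclic := by
    intro k h
    obtain ⟨b, rfl, hb⟩ := M.exists_inl_of_transGen h
    exact hG b (hb b rfl)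

/-- An extension of an assignment of the observed variables to the latent ones. -/
noncomputable def extend (s : ∀ i, S i) : ∀ i, State S L i :=
  Sum.rec s fun j => ⟨(M.latentDist j).support_nonempty.some⟩

/-- A joint assignment is a pair of assignments of the observed and the latent variables. -/
def stateEquiv (S : V → Type u) (L : J → Type) :
    (∀ i, S i) × (∀ j, L j) ≃ (∀ i, State S L i) where
  toFun p := Sum.rec p.1 fun j => ⟨p.2 j⟩
  invFun w := (fun i => w (.inl i), fun j => (w (.inr j)).down)
  left_inv _ := rfl
  right_inv w := by ext (i | j) <;> rfl

theorem tsum_truncated [Fintype V] [Fintype J] (X E : Set V) (s : ∀ i, S i) :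
    ∑' v, {v | ∀ i ∈ E, v i = s i}.indicator (M.truncated X fun i => s i) v =
      sumAgreeing (M.extend s) (Sum.inl '' (X ∪ E)) (weight M.factor (Sum.inl '' X)ᶜ) := by
  classical
  have hsub : sumAgreeing (M.extend s) (Sum.inl '' (X ∪ E)) (weight M.factor (Sum.inl '' X)ᶜ) =
      ∑' w, {w | ∀ i ∈ Sum.inl '' (X ∪ E), w i = M.extend s i}.indicator
        (weight M.factor (Sum.inl '' X)ᶜ) w :=
    tsum_subtype {w : ∀ i, State S L i | ∀ i ∈ Sum.inl '' (X ∪ E), w i = M.extend s i} _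
  rw [hsub, ← (stateEquiv S L).tsum_eq, ENNReal.tsum_prod']
  refine tsum_congr fun v => ?_
  have hw : ∀ u, weight M.factor (Sum.inl '' X)ᶜ (stateEquiv S L (v, u)) =
      (∏ j, M.latentDist j (u j)) * ∏ k ∈ Finset.univ.filter (fun k => k ∉ X),
        M.condDist k (fun p => v p) (fun j => u j) (v k) := by
    intro u
    rw [weight, Fintype.prod_sum_type, mul_comm, Finset.prod_filter]
    congr 1
    · refine Finset.prod_congr rfl fun j _ => ?_
      rw [mulIndicator_of_mem (by simp)]
      rfl
    · refine Finset.prod_congr rfl fun k _ => ?_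
      by_cases hk : k ∈ X
      · rw [mulIndicator_of_notMem (by simpa using hk), if_neg (by simpa using hk)]
      · rw [mulIndicator_of_mem (by simpa using hk), if_pos hk]
        rfl
  have hmem : ∀ u, stateEquiv S L (v, u) ∈
      {w | ∀ i ∈ Sum.inl '' (X ∪ E), w i = M.extend s i} ↔
        (∀ i ∈ E, v i = s i) ∧ ∀ i : X, v i = s i := by
    intro u
    constructor
    · intro h
      exact ⟨fun i hi => h _ ⟨i, .inr hi, rfl⟩, fun i => h _ ⟨i, .inl i.2, rfl⟩⟩
    · rintro ⟨h1, h2⟩ _ ⟨i, hi | hi, rfl⟩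
      · exact h2 ⟨i, hi⟩
      · exact h1 i hi
  by_cases h : (∀ i ∈ E, v i = s i) ∧ ∀ i : X, v i = s i
  · rw [indicator_of_mem (show v ∈ {v | ∀ i ∈ E, v i = s i} from h.1), truncated, if_pos h.2]
    refine tsum_congr fun u => ?_
    rw [indicator_of_mem ((hmem u).2 h), hw]
  · have h0 : ∀ u, {w | ∀ i ∈ Sum.inl '' (X ∪ E), w i = M.extend s i}.indicator
        (weight M.factor (Sum.inl '' X)ᶜ) (stateEquiv S L (v, u)) = 0 := fun u =>
      indicator_of_notMem (fun h' => h ((hmem u).1 h')) _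
    simp only [h0, tsum_zero]
    by_cases h1 : ∀ i ∈ E, v i = s i
    · rw [indicator_of_mem (show v ∈ {v | ∀ i ∈ E, v i = s i} from h1), truncated,
        if_neg fun h2 => h ⟨h1, h2⟩]
    · exact indicator_of_notMem (show v ∉ {v | ∀ i ∈ E, v i = s i} from h1) _

theorem probAt_doDist [Fintype V] [Fintype J] {P : InterventionalFamily S}
    (hP : ∀ (X : Set V) (x : ∀ i : X, S i) (v : ∀ i, S i), P X x v = M.truncated X x v)
    (X E : Set V) (s : ∀ i, S i) :
    (P.doDist X s).probAt s E =
      sumAgreeing (M.extend s) (Sum.inl '' (X ∪ E)) (weight M.factor (Sum.inl '' X)ᶜ) := by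
  rw [← tsum_truncated, PMF.probAt, PMF.toOuterMeasure_apply]
  refine tsum_congr fun v => ?_
  congr 1
  exact funext fun v => hP X _ v

/-! ### Splitting the factors along a set of clusters -/

section Clusters

variable {C : Type*} (c : V → C)

/-- The observed variables in the clusters of `D`, and all latent variables. -/
def observedAndLatent (J : Type*) (D : Set C) : Set (V ⊕ J) := Sum.inl '' (c ⁻¹' D) ∪ range .inr

/-- The observed variables in the clusters of `K`, and their latent parents. -/
def withLatentParents (K : Set C) : Set (V ⊕ J) :=
  Sum.inl '' (c ⁻¹' K) ∪ {x | ∃ k, c k ∈ K ∧ ∃ j ∈ M.latentParents k, x = .inr j}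

variable {c} {D K F X Y W : Set C}

@[simp]
theorem inl_mem_observedAndLatent {v : V} : Sum.inl v ∈ observedAndLatent c J D ↔ c v ∈ D := by
  simp [observedAndLatent]

@[simp]
theorem inr_mem_observedAndLatent {j : J} : Sum.inr j ∈ observedAndLatent c J D := by
  simp [observedAndLatent]

@[simp]
theorem inl_mem_withLatentParents {v : V} : Sum.inl v ∈ M.withLatentParents c K ↔ c v ∈ K := by
  simp [withLatentParents]

@[simp]
theorem inr_mem_withLatentParents {j : J} :
    Sum.inr j ∈ M.withLatentParents c K ↔ ∃ k, c k ∈ K ∧ j ∈ M.latentParents k := by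
  simp [withLatentParents]

theorem inl_mem_scope {v : V} {N : Set (V ⊕ J)} :
    Sum.inl v ∈ scope M.par N ↔ Sum.inl v ∈ N ∨ ∃ k, Sum.inl k ∈ N ∧ G.dir v k := by
  constructor
  · rintro ⟨k | j, hk, h | h⟩
    · exact .inl (h ▸ hk)
    · exact .inr ⟨k, hk, by simpa [par, parents] using h⟩
    · cases h
    · exact h.elim
  · rintro (h | ⟨k, hk, h⟩)
    · exact ⟨_, h, .inl rfl⟩
    · exact ⟨_, hk, .inr (.inl ⟨v, h, rfl⟩)⟩

theorem inr_mem_scope {j : J} {N : Set (V ⊕ J)} :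
    Sum.inr j ∈ scope M.par N ↔ Sum.inr j ∈ N ∨ ∃ k, Sum.inl k ∈ N ∧ j ∈ M.latentParents k := by
  constructor
  · rintro ⟨k | i, hk, h | h⟩
    · cases h
    · exact .inr ⟨k, hk, by simpa [par, parents] using h⟩
    · exact .inl (h ▸ hk)
    · exact h.elim
  · rintro (h | ⟨k, hk, h⟩)
    · exact ⟨_, h, .inl rfl⟩
    · exact ⟨_, hk, .inr (.inr ⟨j, h, rfl⟩)⟩

theorem mem_of_inl_mem_scope_withLatentParents
    (hdl : ∀ i ∈ K, ∀ j ∈ D, (G.clusterGraph c).dir j i → j ∉ F → j ∈ K) {v : V}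
    (hv : Sum.inl v ∈ scope M.par (M.withLatentParents c K)) (hD : c v ∈ D) (hF : c v ∉ F) :
    c v ∈ K := by
  rcases M.inl_mem_scope.1 hv with h | ⟨k, hk, h⟩
  · exact M.inl_mem_withLatentParents.1 h
  · rw [inl_mem_withLatentParents] at hk
    by_cases hvk : c v = c k
    · rwa [hvk]
    · exact hdl _ hk _ hD ⟨hvk, v, k, rfl, rfl, h⟩ hF

/-- If `K` is closed under adjacency in `D` except through parents in `F`, then its factors share
only variables of `F` with the other factors of `D`. -/
theorem scope_inter_scope_subset
    (hbi : ∀ i ∈ K, ∀ j ∈ D, (G.clusterGraph c).bidir i j → j ∈ K)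
    (hdl : ∀ i ∈ K, ∀ j ∈ D, (G.clusterGraph c).dir j i → j ∉ F → j ∈ K)
    (hdr : ∀ i ∈ K, ∀ j ∈ D, (G.clusterGraph c).dir i j → i ∉ F → j ∈ K) :
    scope M.par (M.withLatentParents c K) ∩
      scope M.par (observedAndLatent c J D \ M.withLatentParents c K) ⊆
        Sum.inl '' (c ⁻¹' (F ∪ Dᶜ)) := by
  rintro (v | j) ⟨h1, h2⟩
  · refine ⟨v, ?_, rfl⟩
    by_contra hv
    simp only [mem_preimage, mem_union, mem_compl_iff, not_or, not_not] at hv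
    have hK := M.mem_of_inl_mem_scope_withLatentParents hdl h1 hv.2 hv.1
    rcases M.inl_mem_scope.1 h2 with h | ⟨k, hk, h⟩
    · exact h.2 (M.inl_mem_withLatentParents.2 hK)
    · simp only [mem_sdiff, inl_mem_observedAndLatent, inl_mem_withLatentParents] at hk
      by_cases hvk : c v = c k
      · exact hk.2 (hvk ▸ hK)
      · exact hk.2 (hdr _ hK _ hk.1 ⟨hvk, v, k, rfl, rfl, h⟩ hv.1)
  · exfalso
    have h1' : ∃ k, c k ∈ K ∧ j ∈ M.latentParents k := by
      rcases M.inr_mem_scope.1 h1 with h | ⟨k, hk, h⟩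
      · exact M.inr_mem_withLatentParents.1 h
      · exact ⟨k, M.inl_mem_withLatentParents.1 hk, h⟩
    rcases M.inr_mem_scope.1 h2 with h | ⟨k, hk, h⟩
    · exact h.2 (M.inr_mem_withLatentParents.2 h1')
    · obtain ⟨i, hi, hj⟩ := h1'
      simp only [mem_sdiff, inl_mem_observedAndLatent, inl_mem_withLatentParents] at hk
      by_cases hik : c i = c k
      · exact hk.2 (hik ▸ hi)
      · exact hk.2 (hbi _ hi _ hk.1 ⟨hik, i, k, rfl, rfl,
          (M.bidir_iff i k (fun h => hik (congrArg c h))).2 ⟨j, hj, h⟩⟩)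

/-- Under `do(X)`, only the factors of a set `D` that contains its parents outside of `X` matter
for the distribution of variables in `D`. -/
theorem probAt_doDist_eq_sumAgreeing [Fintype V] [Fintype J] (hG : G.Acyclic)
    {P : InterventionalFamily S}
    (hP : ∀ (X : Set V) (x : ∀ i : X, S i) (v : ∀ i, S i), P X x v = M.truncated X x v)
    (hpar : ∀ i ∈ D, ∀ j, (G.clusterGraph c).dir j i → j ∈ D ∪ X) (hW : W ⊆ D ∪ X)
    (s : ∀ i, S i) :
    (P.doDist (c ⁻¹' X) s).probAt s (c ⁻¹' W) =
      sumAgreeing (M.extend s) (Sum.inl '' (c ⁻¹' (X ∪ W ∪ Dᶜ)))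
        (weight M.factor (observedAndLatent c J D \ Sum.inl '' (c ⁻¹' X))) := by
  have hN : (Sum.inl '' (c ⁻¹' X))ᶜ = (observedAndLatent c J D \ Sum.inl '' (c ⁻¹' X)) ∪
      Sum.inl '' (c ⁻¹' (X ∪ D)ᶜ) := by
    ext (v | j)
    · by_cases h1 : c v ∈ X <;> by_cases h2 : c v ∈ D <;> simp [h1, h2]
    · simp
  rw [M.probAt_doDist hP, hN, (M.isFactorization hG).sumAgreeing_weight_union]
  · congr 1
    rw [← image_union, ← preimage_union, ← preimage_union]
    congr 2
    ext i
    by_cases h1 : i ∈ X <;> by_cases h2 : i ∈ D <;> simp [h1, h2]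
  · rw [Set.disjoint_left]
    rintro (v | j) hv
    · simp only [mem_sdiff, inl_mem_observedAndLatent] at hv
      simp [hv.1]
    · simp
  · rw [Set.disjoint_left]
    rintro _ ⟨v, hv, rfl⟩ ⟨v', hv', h⟩
    cases h
    rcases hv with hv | hv
    · exact hv' (.inl hv)
    · exact hv' (hW hv).symm
  · rintro (k | j) hk
    · rw [Set.disjoint_left]
      rintro _ (⟨p, hp, rfl⟩ | ⟨j, hj, rfl⟩) ⟨v', hv', h⟩
      · cases h
        simp only [mem_sdiff, inl_mem_observedAndLatent] at hk
        by_cases hpk : c p = c k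
        · exact hv' (.inr (hpk ▸ hk.1))
        · exact hv' (hpar _ hk.1 _ ⟨hpk, p, k, rfl, rfl, hp⟩).symm
      · cases h
    · exact Set.disjoint_left.2 fun _ h => h.elim

/-- Under `do(X)`, the conditional distribution of `Y` given `W` does not depend on the factors of
a set `K` of clusters that shares only fixed variables with the rest of `D`. -/
theorem condProbAt_doDist_eq [Fintype V] [Fintype J] (hG : G.Acyclic)
    {P : InterventionalFamily S}
    (hP : ∀ (X : Set V) (x : ∀ i : X, S i) (v : ∀ i, S i), P X x v = M.truncated X x v)
    (hbi : ∀ i ∈ K, ∀ j ∈ D, (G.clusterGraph c).bidir i j → j ∈ K)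
    (hdl : ∀ i ∈ K, ∀ j ∈ D, (G.clusterGraph c).dir j i → j ∉ F → j ∈ K)
    (hdr : ∀ i ∈ K, ∀ j ∈ D, (G.clusterGraph c).dir i j → i ∉ F → j ∈ K)
    (hYD : Y ⊆ D) (hYF : Disjoint Y F) (hYK : Disjoint Y K)
    (hpar : ∀ i ∈ D, ∀ j, (G.clusterGraph c).dir j i → j ∈ D ∪ X) (hW : W ⊆ D ∪ X)
    (hX : X ∩ D ⊆ K) (hF : F ⊆ X ∪ W ∪ Dᶜ) (s : ∀ i, S i)
    (h0 : (P.doDist (c ⁻¹' X) s).probAt s (c ⁻¹' W) ≠ 0) {Q : Set C}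
    (hQ : X ∪ W ∪ Dᶜ ∪ K = Q) :
    (P.doDist (c ⁻¹' X) s).condProbAt s (c ⁻¹' Y) (c ⁻¹' W) =
      sumAgreeing (M.extend s) (Sum.inl '' (c ⁻¹' Y) ∪
        (Sum.inl '' (c ⁻¹' Q) ∪ scope M.par (M.withLatentParents c K)))
        (weight M.factor (observedAndLatent c J D \ M.withLatentParents c K)) /
      sumAgreeing (M.extend s)
        (Sum.inl '' (c ⁻¹' Q) ∪ scope M.par (M.withLatentParents c K))
        (weight M.factor (observedAndLatent c J D \ M.withLatentParents c K)) := by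
  have htop : (P.doDist (c ⁻¹' X) s).probAt s (c ⁻¹' W) ≠ ⊤ := by
    rw [PMF.probAt, PMF.toOuterMeasure_apply]
    exact PMF.tsum_coe_indicator_ne_top _ _
  -- By `hX` the intervention deletes factors of `K` only, so the second part is the same for all
  -- admissible `X`.
  have hNR : observedAndLatent c J D \ Sum.inl '' (c ⁻¹' X) =
      ((observedAndLatent c J D ∩ M.withLatentParents c K) \ Sum.inl '' (c ⁻¹' X)) ∪
        (observedAndLatent c J D \ M.withLatentParents c K) := by
    ext (v | j)
    · have := @hX (c v)
      simp only [mem_sdiff, mem_union, mem_inter_iff, inl_mem_observedAndLatent,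
        inl_mem_withLatentParents, mem_image, Sum.inl.injEq, exists_eq_right, mem_preimage] at this ⊢
      tauto
    · simp only [mem_sdiff, mem_union, mem_inter_iff, inr_mem_observedAndLatent, mem_image,
        reduceCtorEq, and_false, exists_false, not_false_eq_true, true_and, and_true]
      tauto
  -- The scope of `K` already contains the variables of `K`, so the fixed set depends on `X` and `W`
  -- only through `Q`.
  have hQ' : Sum.inl '' (c ⁻¹' (X ∪ W ∪ Dᶜ)) ∪ scope M.par (M.withLatentParents c K) =
      Sum.inl '' (c ⁻¹' Q) ∪ scope M.par (M.withLatentParents c K) := by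
    rw [← hQ, preimage_union (t := K), image_union,
      union_assoc _ (Sum.inl '' (c ⁻¹' K)), union_eq_self_of_subset_left (s := Sum.inl '' (c ⁻¹' K))]
    rintro _ ⟨v, hv, rfl⟩
    exact M.inl_mem_scope.2 (.inl (M.inl_mem_withLatentParents.2 hv))
  have hYW : X ∪ (Y ∪ W) ∪ Dᶜ = Y ∪ (X ∪ W ∪ Dᶜ) := by
    rw [← union_assoc X, union_comm X Y, union_assoc Y, union_assoc Y]
  rw [PMF.condProbAt, ← preimage_union,
    M.probAt_doDist_eq_sumAgreeing hG hP hpar (union_subset (hYD.trans subset_union_left) hW), hYW]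
  rw [M.probAt_doDist_eq_sumAgreeing hG hP hpar hW] at h0 htop ⊢
  rw [preimage_union (s := Y), image_union, ← hQ']
  rw [hNR] at h0 htop ⊢
  refine (M.isFactorization hG).sumAgreeing_weight_div _ (fun i hi => hi.1.2)
    (Set.disjoint_left.2 fun i hi hi' => hi'.2 hi.1.2)
    ((M.scope_inter_scope_subset hbi hdl hdr).trans ?_) (Set.disjoint_left.2 ?_) h0 htop
  · exact image_mono (preimage_mono (union_subset hF subset_union_right))
  · rintro _ ⟨v, hv, rfl⟩ h
    exact Set.disjoint_left.1 hYK hv (M.mem_of_inl_mem_scope_withLatentParents hdl h (hYD hv)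
      (Set.disjoint_left.1 hYF hv))

end Clusters

end MixedGraph.LatentModel

/-! ### From d-separation of clusters to invariance of conditional distributions -/

namespace MixedGraph

/-- A d-separation of `Y` and `Z` in a graph `H`, which has all edges of the cluster graph in `D`
except those out of `F`, determines the conditional distributions of `Y` irrespective of how the
variables of `Z` are treated. -/
theorem exists_condProbAt_doDist_eq [Fintype V] {G : MixedGraph V} (hG : G.Acyclic)
    {P : InterventionalFamily S} (hP : G.IsCBN P) {C : Type*} {c : V → C} {H : MixedGraph C}
    {D F X Y Z T : Set C} (hH : H.Acyclic) (hsep : H.DSep Y Z T)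
    (hD : ∀ i ∈ D, ∃ d ∈ Y ∪ Z ∪ T, H.IsAncestor i d)
    (hbi : ∀ i ∈ D, ∀ j ∈ D, (G.clusterGraph c).bidir i j → H.bidir i j)
    (hdir : ∀ i ∈ D, ∀ j ∈ D, (G.clusterGraph c).dir i j → i ∉ F → H.dir i j)
    (hTF : T ⊆ F) (hYD : Y ⊆ D) (hYF : Disjoint Y F) (hZT : Disjoint Z T)
    (hpar : ∀ i ∈ D, ∀ j, (G.clusterGraph c).dir j i → j ∈ D ∪ X) (s : ∀ i, S i) (Q : Set C) :
    ∃ r, ∀ X' W', X ⊆ X' → X' ∩ D ⊆ Z → F ⊆ X' ∪ W' ∪ Dᶜ → W' ⊆ D ∪ X' →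
      X' ∪ W' ∪ Dᶜ ∪ Z = Q → (P.doDist (c ⁻¹' X') s).probAt s (c ⁻¹' W') ≠ 0 →
      (P.doDist (c ⁻¹' X') s).condProbAt s (c ⁻¹' Y) (c ⁻¹' W') = r := by
  obtain ⟨J, _, L, M, hM⟩ := hP
  have hKD : H.linked T Z D ⊆ D := fun i hi => hi.1
  refine ⟨_, fun X' W' hX hXD hF hW hQ h0 => M.condProbAt_doDist_eq hG hM
    (K := H.linked T Z D) (D := D) (F := F) (Q := Q ∪ H.linked T Z D)
    (fun i hi j hj hij => mem_linked_of_bidir hH hsep hD hi (hbi _ (hKD hi) _ hj hij) hj)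
    (fun i hi j hj hji hjF => mem_linked_of_dir_left hH hsep hD hi
      (hdir _ hj _ (hKD hi) hji hjF) hj (fun h => hjF (hTF h)))
    (fun i hi j hj hij hiF => mem_linked_of_dir_right hi (hdir _ (hKD hi) _ hj hij hiF) hj
      (fun h => hiF (hTF h)))
    hYD hYF (Set.disjoint_left.2 fun i hi hi' => not_mem_of_mem_linked hH hsep hi' hi)
    (fun i hi j hji => (hpar i hi j hji).imp id (fun h => hX h)) hW
    (fun i hi => mem_linked_of_mem hZT (hXD hi) hi.2) hF s h0 ?_⟩
  rw [← hQ]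
  ext i
  have : i ∈ Z → i ∈ D → i ∈ H.linked T Z D := mem_linked_of_mem hZT
  simp only [mem_union, mem_compl_iff]
  tauto

theorem Acyclic.mono {H H' : MixedGraph V} (h : H.Acyclic) (hle : ∀ a b, H'.dir a b → H.dir a b) :
    H'.Acyclic := fun v hv => h v (Relation.TransGen.mono hle _ _ hv)

/-- A vertex without incoming edges has no ancestors but itself. -/
theorem eq_of_isAncestor {H : MixedGraph V} {a b : V} (hb : ∀ p, ¬ H.dir p b)
    (h : H.IsAncestor a b) : a = b := by
  rcases Relation.ReflTransGen.cases_tail h with h | ⟨p, -, h⟩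
  · exact h.symm
  · exact absurd h (hb p)

/-- The special case of `exists_condProbAt_doDist_eq` for an ancestral set `D`, where `Z` is in part
intervened on and in part conditioned on or summed out. -/
theorem exists_condProbAt_eq_of_dSep [Fintype V] {G : MixedGraph V} (hG : G.Acyclic)
    {P : InterventionalFamily S} (hP : G.IsCBN P) {C : Type*} {c : V → C}
    (hac : (G.clusterGraph c).Acyclic) {H : MixedGraph C} {X Y Z W N R D : Set C}
    (hXY : Disjoint X Y) (hXZ : Disjoint X Z) (hXW : Disjoint X W)
    (hYZ : Disjoint Y Z) (hYW : Disjoint Y W) (hZW : Disjoint Z W)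
    (hsep : H.DSep Y Z (X ∪ W)) (hle : ∀ i j, H.dir i j → (G.clusterGraph c).dir i j)
    (hD : D = {i | i ∉ X ∧ ∃ d ∈ R, H.IsAncestor i d}) (hR : R ⊆ Y ∪ Z ∪ W) (hYWR : Y ∪ W ⊆ R)
    (hN : N ⊆ Z) (hNR : N ⊆ R)
    (hbi : ∀ i ∈ D, ∀ j ∈ D, (G.clusterGraph c).bidir i j → H.bidir i j)
    (hdir : ∀ i ∈ D, ∀ j, (G.clusterGraph c).dir j i → j ∈ N ∨ H.dir j i) (s : ∀ i, S i) :
    ∃ r, ∀ Z₁ ⊆ Z, ∀ Z₂ ⊆ Z ∩ D, N ⊆ Z₁ ∪ Z₂ →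
      (P.doDist (c ⁻¹' (X ∪ Z₁)) s).probAt s (c ⁻¹' (Z₂ ∪ W)) ≠ 0 →
      (P.doDist (c ⁻¹' (X ∪ Z₁)) s).condProbAt s (c ⁻¹' Y) (c ⁻¹' (Z₂ ∪ W)) = r := by
  have hmem : ∀ i ∈ R, i ∉ X → i ∈ D := fun i hi hX => hD ▸ ⟨hX, i, hi, .refl⟩
  have hYD : Y ⊆ D := fun i hi => hmem i (hYWR (.inl hi)) (Set.disjoint_right.1 hXY hi)
  have hWD : W ⊆ D := fun i hi => hmem i (hYWR (.inr hi)) (Set.disjoint_right.1 hXW hi)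
  have hDX : Disjoint D X := Set.disjoint_left.2 fun i hi => (hD ▸ hi : i ∈ {i | _}).1
  have hanc : ∀ i ∈ D, ∃ d ∈ Y ∪ Z ∪ (X ∪ W), H.IsAncestor i d := by
    intro i hi
    rw [hD] at hi
    obtain ⟨-, d, hd, hid⟩ := hi
    exact ⟨d, (hR hd).imp id .inr, hid⟩
  have hpar : ∀ i ∈ D, ∀ j, (G.clusterGraph c).dir j i → j ∈ D ∪ X := by
    intro i hi j hji
    by_cases hj : j ∈ X
    · exact .inr hj
    · left
      rcases hdir i hi j hji with h | h
      · exact hmem j (hNR h) hj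
      · rw [hD] at hi ⊢
        obtain ⟨-, d, hd, hid⟩ := hi
        exact ⟨hj, d, hd, .head h hid⟩
  -- `N` joins the fixed clusters because edges out of it may be missing in `H`. The set `X ∪ W ∪ Dᶜ
  -- ∪ Z` is the same however `Z` is divided into intervened, observed and summed out clusters.
  obtain ⟨r, hr⟩ := exists_condProbAt_doDist_eq hG hP (F := X ∪ W ∪ N) (X := X) (D := D)
    (hac.mono hle) hsep hanc hbi
    (fun i _ j hj h hiF => (hdir j hj i h).resolve_left fun h => hiF (.inr h))
    subset_union_left hYD
    (Set.disjoint_union_right.2 ⟨Set.disjoint_union_right.2 ⟨hXY.symm, hYW⟩, hYZ.mono_right hN⟩)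
    (Set.disjoint_union_right.2 ⟨hXZ.symm, hZW⟩) hpar s (X ∪ W ∪ Dᶜ ∪ Z)
  refine ⟨r, fun Z₁ hZ₁ Z₂ hZ₂ hNZ h0 => hr _ _ subset_union_left ?_ ?_ ?_ ?_ h0⟩
  · rintro i ⟨hi | hi, hiD⟩
    · exact absurd hi (Set.disjoint_left.1 hDX hiD)
    · exact hZ₁ hi
  · rintro i ((hi | hi) | hi)
    · exact .inl (.inl (.inl hi))
    · exact .inl (.inr (.inr hi))
    · exact .inl ((hNZ hi).imp .inr .inl)
  · rintro i (hi | hi)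
    · exact .inl (hZ₂ hi).2
    · exact .inl (hWD hi)
  · ext i
    have h1 := @hZ₁ i
    have h2 : i ∈ Z₂ → i ∈ Z := fun hi => (hZ₂ hi).1
    simp only [mem_union, mem_compl_iff]
    tauto

/-- Once the edges into `Z(W)` are removed as well, a d-separation of `Y` and `Z` implies that no
vertex of `Z(W)` is an ancestor of `Y` or `W`. -/
theorem not_isAncestor_of_mem_nonAncestors {H : MixedGraph V} (hH : H.Acyclic)
    {X Y Z W : Set V} (hXZ : Disjoint X Z)
    (hsep : ((H.removeInto X).removeInto ((H.removeInto X).nonAncestors Z W)).DSep Y Z (X ∪ W))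
    {z d : V} (hz : z ∈ (H.removeInto X).nonAncestors Z W) (hd : d ∈ Y ∪ W) :
    ¬ ((H.removeInto X).removeInto ((H.removeInto X).nonAncestors Z W)).IsAncestor z d := by
  have hW : ∀ w ∈ W,
      ¬ ((H.removeInto X).removeInto ((H.removeInto X).nonAncestors Z W)).IsAncestor z w :=
    fun w hw h => hz.2 w hw (Relation.ReflTransGen.mono
      (fun a b (h : ((H.removeInto X).removeInto _).dir a b) => h.1) _ _ h)
  rcases hd with hd | hd
  · intro hzd
    -- A directed path from `z` to `d ∈ Y` would be active when read backwards, since `z` has no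
    -- descendant in `X ∪ W`.
    obtain ⟨l, hl⟩ := exists_isActiveWalkTo_of_isAncestor (T := X ∪ W) (B := Z) hzd
      (by
        rintro ⟨t, ht | ht, hzt⟩
        · have := eq_of_isAncestor (H := (H.removeInto X).removeInto _) (fun p hp => hp.1.2 ht) hzt
          exact Set.disjoint_left.1 hXZ ht (this ▸ hz.1)
        · exact hW t ht hzt)
      ⟨[], z, hz.1, rfl, trivial⟩
    exact hsep.not_isActiveWalkTo (hH.mono fun a b
      (h : ((H.removeInto X).removeInto _).dir a b) => h.1.1) hd l hl
  · exact hW d hd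

end MixedGraph

end Model

/-! ### The three rules -/

theorem theorem3 {V C : Type*} [Fintype V] (S : V → Type*)
    (G : MixedGraph V) (hG : G.Acyclic)
    (c : V → C) (GC : MixedGraph C) (hGC : GC.IsCompatibleCDAG G c)
    (P : InterventionalFamily S) (hP : G.IsCBN P)
    (X Y Z W : Set C)
    (hXY : Disjoint X Y) (hXZ : Disjoint X Z) (hXW : Disjoint X W)
    (hYZ : Disjoint Y Z) (hYW : Disjoint Y W) (hZW : Disjoint Z W) :
    -- Rule 1
    ((GC.removeInto X).DSep Y Z (X ∪ W) →
      ∀ s : ∀ i, S i,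
        (P.doDist (c ⁻¹' X) s).probAt s (c ⁻¹' (Z ∪ W)) ≠ 0 →
        (P.doDist (c ⁻¹' X) s).condProbAt s (c ⁻¹' Y) (c ⁻¹' (Z ∪ W)) =
          (P.doDist (c ⁻¹' X) s).condProbAt s (c ⁻¹' Y) (c ⁻¹' W)) ∧
    -- Rule 2
    (((GC.removeInto X).removeOutOf Z).DSep Y Z (X ∪ W) →
      ∀ s : ∀ i, S i,
        (P.doDist (c ⁻¹' (X ∪ Z)) s).probAt s (c ⁻¹' W) ≠ 0 →
        (P.doDist (c ⁻¹' X) s).probAt s (c ⁻¹' (Z ∪ W)) ≠ 0 →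
        (P.doDist (c ⁻¹' (X ∪ Z)) s).condProbAt s (c ⁻¹' Y) (c ⁻¹' W) =
          (P.doDist (c ⁻¹' X) s).condProbAt s (c ⁻¹' Y) (c ⁻¹' (Z ∪ W))) ∧
    -- Rule 3
    (((GC.removeInto X).removeInto ((GC.removeInto X).nonAncestors Z W)).DSep Y Z (X ∪ W) →
      ∀ s : ∀ i, S i,
        (P.doDist (c ⁻¹' (X ∪ Z)) s).probAt s (c ⁻¹' W) ≠ 0 →
        (P.doDist (c ⁻¹' X) s).probAt s (c ⁻¹' W) ≠ 0 →
        (P.doDist (c ⁻¹' (X ∪ Z)) s).condProbAt s (c ⁻¹' Y) (c ⁻¹' W) =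
          (P.doDist (c ⁻¹' X) s).condProbAt s (c ⁻¹' Y) (c ⁻¹' W)) := by
  obtain ⟨-, rfl, hac⟩ := hGC
  refine ⟨fun hsep s h0 => ?_, fun hsep s h0 h1 => ?_, fun hsep s h0 h1 => ?_⟩
  · obtain ⟨r, hr⟩ := MixedGraph.exists_condProbAt_eq_of_dSep hG hP hac (N := ∅)
      (R := Y ∪ Z ∪ W) hXY hXZ hXW hYZ hYW hZW hsep (fun _ _ h => h.1) rfl subset_rfl
      (Set.union_subset_union_left _ Set.subset_union_left) (by simp) (by simp)
      (fun i hi j hj h => ⟨h, hi.1, hj.1⟩) (fun i hi j h => .inr ⟨h, hi.1⟩) s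
    have hZD : Z ⊆ Z ∩ {i | i ∉ X ∧ ∃ d ∈ Y ∪ Z ∪ W,
        ((G.clusterGraph c).removeInto X).IsAncestor i d} := fun i hi =>
      ⟨hi, Set.disjoint_right.1 hXZ hi, i, .inl (.inr hi), .refl⟩
    have h1 : (P.doDist (c ⁻¹' X) s).probAt s (c ⁻¹' W) ≠ 0 := fun h => h0 <|
      le_antisymm (h ▸ MeasureTheory.measure_mono fun v hv i hi => hv i (.inr hi)) zero_le
    have e1 := hr ∅ (by simp) Z hZD (by simp)
    have e2 := hr ∅ (by simp) ∅ (by simp) (by simp)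
    simp only [Set.union_empty, Set.empty_union] at e1 e2
    rw [e1 h0, e2 h1]
  -- The removed edges leave `Z`, which both sides hold fixed, once by intervention and once by
  -- conditioning; hence `N = Z`.
  · obtain ⟨r, hr⟩ := MixedGraph.exists_condProbAt_eq_of_dSep hG hP hac (N := Z)
      (R := Y ∪ Z ∪ W) hXY hXZ hXW hYZ hYW hZW hsep (fun _ _ h => h.1.1) rfl subset_rfl
      (Set.union_subset_union_left _ Set.subset_union_left) subset_rfl (fun i hi => .inl (.inr hi))
      (fun i hi j hj h => ⟨h, hi.1, hj.1⟩)
      (fun i hi j h => (em (j ∈ Z)).imp id fun hj => ⟨⟨h, hi.1⟩, hj⟩) s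
    have hZD : Z ⊆ Z ∩ {i | i ∉ X ∧ ∃ d ∈ Y ∪ Z ∪ W,
        (((G.clusterGraph c).removeInto X).removeOutOf Z).IsAncestor i d} := fun i hi =>
      ⟨hi, Set.disjoint_right.1 hXZ hi, i, .inl (.inr hi), .refl⟩
    have e1 := hr Z subset_rfl ∅ (by simp) (by simp)
    have e2 := hr ∅ (by simp) Z hZD (by simp)
    simp only [Set.union_empty, Set.empty_union] at e1 e2
    rw [e1 h0, e2 h1]
  -- Here one side sums `Z` out, so only the ancestors of `Y ∪ W` are kept. No cluster of `Z(W)` is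
  -- among them, so removing the edges into `Z(W)` changes nothing within `D`.
  · have hZ : ∀ i, (∃ d ∈ Y ∪ W, (((G.clusterGraph c).removeInto X).removeInto
        (((G.clusterGraph c).removeInto X).nonAncestors Z W)).IsAncestor i d) →
        i ∉ ((G.clusterGraph c).removeInto X).nonAncestors Z W := fun i ⟨d, hd, hid⟩ hi =>
      MixedGraph.not_isAncestor_of_mem_nonAncestors hac hXZ hsep hi hd hid
    obtain ⟨r, hr⟩ := MixedGraph.exists_condProbAt_eq_of_dSep hG hP hac (N := ∅)
      (R := Y ∪ W) hXY hXZ hXW hYZ hYW hZW hsep (fun _ _ h => h.1.1) rfl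
      (Set.union_subset_union_left _ Set.subset_union_left) subset_rfl (by simp) (by simp)
      (fun i hi j hj h => ⟨⟨h, hi.1, hj.1⟩, hZ i hi.2, hZ j hj.2⟩)
      (fun i hi j h => .inr ⟨⟨h, hi.1⟩, hZ i hi.2⟩) s
    have e1 := hr Z subset_rfl ∅ (by simp) (by simp)
    have e2 := hr ∅ (by simp) ∅ (by simp) (by simp)
    simp only [Set.union_empty, Set.empty_union] at e1 e2
    rw [e1 h0, e2 h1]
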